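/- Let $d\ge 2$ be an integer. Let $H^2_d$ be the Drury–Arveson space, i.e. the reproducing kernel Hilbert space on the open unit ball $\mathbb B_d\subset\mathbb C^d$ with kernel $k_d(z,w)=\frac{1}{1-\langle z,w\rangle}$, and let $\mathcal M_d\subset B(H^2_d)$ be its multiplier algebra, the algebra of all operators $f\mapsto\varphi f$ where $\varphi\colon\mathbb B_d\to\mathbb C$ satisfies $\varphi H^2_d\subset H^2_d$. Let $M_6(\mathcal M_d)$ be the algebra of $6\times 6$ matrices over $\mathcal M_d$, acting on the Hilbert space $H^2_d\otimes\mathbb C^6=(H^2_d)^{\oplus 6}$. A weak-$*$ closed subalgebra $\mathfrak A\subset B(\mathcal H)$ is said to have property $\mathbb A_1(1)$ if for every weak-$*$ continuous linear functional $\psi$ on $\mathfrak A$ with $\|\psi\|<1$ there exist $\xi,\eta\in\mathcal H$ with $\|\xi\|<1$, $\|\eta\|<1$ such that $\psi(T)=\langle T\xi,\eta\rangle$ for every $T\in\mathfrak A$. Then $M_6(\mathcal M_d)\subset B(H^2_d\otimes\mathbb C^6)$ does not have property $\mathbb A_1(1)$. -/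

import Mathlib

noncomputable section

/-- The open unit ball of `ℂ^d` with the Euclidean norm. -/
abbrev UnitBall (d : ℕ) : Type := Metric.ball (0 : EuclideanSpace ℂ (Fin d)) 1

/-- The kernel `k_d(z, w) = 1 / (1 - ⟨z, w⟩)` on the unit ball, where `⟨z, w⟩ = ∑ z_i * conj w_i` is
Mathlib's `inner ℂ w z`. A scalar `c` is viewed as the operator `c • id` on `ℂ`. -/
def druryArvesonKernel (d : ℕ) : Matrix (UnitBall d) (UnitBall d) (ℂ →L[ℂ] ℂ) :=
  Matrix.of fun z w =>
    (1 / (1 - inner ℂ (w : EuclideanSpace ℂ (Fin d)) (z : EuclideanSpace ℂ (Fin d)))) •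
      ContinuousLinearMap.id ℂ ℂ

theorem hasSum_druryArvesonKernel {d : ℕ} (z w : UnitBall d) :
    HasSum (fun n : ℕ =>
        (inner ℂ (w : EuclideanSpace ℂ (Fin d)) (z : EuclideanSpace ℂ (Fin d))) ^ n)
      (1 / (1 - inner ℂ (w : EuclideanSpace ℂ (Fin d)) (z : EuclideanSpace ℂ (Fin d)))) := by
  rw [one_div]
  apply hasSum_geometric_of_norm_lt_one
  have hz : ‖(z : EuclideanSpace ℂ (Fin d))‖ < 1 := mem_ball_zero_iff.mp z.2
  have hw : ‖(w : EuclideanSpace ℂ (Fin d))‖ < 1 := mem_ball_zero_iff.mp w.2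
  calc _ ≤ ‖(w : EuclideanSpace ℂ (Fin d))‖ * ‖(z : EuclideanSpace ℂ (Fin d))‖ :=
        norm_inner_le_norm _ _
    _ < 1 := mul_lt_one_of_nonneg_of_lt_one_left (norm_nonneg _) hw hz.le

theorem re_sum_inner_pow_nonneg {d : ℕ} (n : ℕ) (s : Finset (UnitBall d)) (v : UnitBall d → ℂ) :
    0 ≤ (∑ x ∈ s, ∑ y ∈ s, (inner ℂ (y : EuclideanSpace ℂ (Fin d))
      (x : EuclideanSpace ℂ (Fin d))) ^ n * (v x * starRingEnd ℂ (v y))).re := by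
  have key : (∑ x ∈ s, ∑ y ∈ s, (inner ℂ (y : EuclideanSpace ℂ (Fin d))
      (x : EuclideanSpace ℂ (Fin d))) ^ n * (v x * starRingEnd ℂ (v y))) =
      ∑ p : Fin n → Fin d,
        (∑ x ∈ s, v x * ∏ i, (x : EuclideanSpace ℂ (Fin d)) (p i)) *
        starRingEnd ℂ (∑ x ∈ s, v x * ∏ i, (x : EuclideanSpace ℂ (Fin d)) (p i)) := by
    simp only [map_sum, Finset.sum_mul_sum]
    rw [Finset.sum_comm]
    simp only [Finset.sum_comm (s := Finset.univ (α := Fin n → Fin d))]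
    rw [Finset.sum_comm]
    refine Finset.sum_congr rfl fun x _ => Finset.sum_congr rfl fun y _ => ?_
    rw [PiLp.inner_apply, Fintype.sum_pow, Finset.sum_mul]
    refine Finset.sum_congr rfl fun p _ => ?_
    simp only [RCLike.inner_apply, Finset.prod_mul_distrib, map_mul, map_prod]
    ring
  rw [key, Complex.re_sum]
  refine Finset.sum_nonneg fun p _ => ?_
  rw [Complex.mul_conj]
  simpa using Complex.normSq_nonneg _

theorem posSemidef_druryArvesonKernel (d : ℕ) : (druryArvesonKernel d).PosSemidef := by
  have htfae := (RKHS.posSemidef_tfae (K := druryArvesonKernel d)).out 0 2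
  refine htfae.mpr ⟨?_, fun vv => ?_⟩
  · refine Matrix.ext fun z w => ContinuousLinearMap.ext fun v => ext_inner_right ℂ fun u => ?_
    rw [Matrix.conjTranspose_apply, ContinuousLinearMap.star_eq_adjoint,
      ContinuousLinearMap.adjoint_inner_left]
    simp [druryArvesonKernel, mul_left_comm, mul_assoc]
  · have h : HasSum (fun n : ℕ => ∑ x ∈ vv.support, ∑ y ∈ vv.support,
        (inner ℂ (y : EuclideanSpace ℂ (Fin d)) (x : EuclideanSpace ℂ (Fin d))) ^ n *
          (vv y * starRingEnd ℂ (vv x)))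
        (vv.sum fun x w => vv.sum fun y w' => inner ℂ (druryArvesonKernel d y x w) w') := by
      refine hasSum_sum fun x _ => hasSum_sum fun y _ => ?_
      have := (hasSum_druryArvesonKernel x y).mul_right (vv y * starRingEnd ℂ (vv x))
      have hv : inner ℂ (druryArvesonKernel d y x (vv x)) (vv y) = 1 / (1 -
          inner ℂ (y : EuclideanSpace ℂ (Fin d)) (x : EuclideanSpace ℂ (Fin d))) *
            (vv y * starRingEnd ℂ (vv x)) := by
        simp [druryArvesonKernel, mul_left_comm]
      rw [← hv] at this
      exact this
    refine (Complex.hasSum_re h).nonneg fun n => ?_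
    refine (re_sum_inner_pow_nonneg n vv.support fun x => starRingEnd ℂ (vv x)).trans_eq ?_
    refine congrArg Complex.re (Finset.sum_congr rfl fun x _ => Finset.sum_congr rfl fun y _ => ?_)
    rw [Complex.conj_conj, mul_comm (vv y)]

instance (d : ℕ) : Fact (druryArvesonKernel d).PosSemidef := ⟨posSemidef_druryArvesonKernel d⟩

/-- The Drury–Arveson space `H^2_d`: the Hilbert space of functions on the unit ball of `ℂ^d` with
reproducing kernel `druryArvesonKernel d`. -/
def DruryArveson (d : ℕ) : Type := RKHS.OfKernel (druryArvesonKernel d)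

instance (d : ℕ) : NormedAddCommGroup (DruryArveson d) :=
  inferInstanceAs (NormedAddCommGroup (RKHS.OfKernel (druryArvesonKernel d)))

instance (d : ℕ) : InnerProductSpace ℂ (DruryArveson d) :=
  inferInstanceAs (InnerProductSpace ℂ (RKHS.OfKernel (druryArvesonKernel d)))

instance (d : ℕ) : CompleteSpace (DruryArveson d) :=
  inferInstanceAs (CompleteSpace (RKHS.OfKernel (druryArvesonKernel d)))

instance (d : ℕ) : RKHS ℂ (DruryArveson d) (UnitBall d) ℂ :=
  inferInstanceAs (RKHS ℂ (RKHS.OfKernel (druryArvesonKernel d)) (UnitBall d) ℂ)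

theorem kernel_druryArveson (d : ℕ) : RKHS.kernel (DruryArveson d) = druryArvesonKernel d :=
  RKHS.OfKernel.kernel_ofKernel

/-- `φ` is a multiplier of the space of functions `H` if `φ * f ∈ H` for every `f ∈ H`. -/
def IsMultiplier (H : Type*) {X : Type*} [NormedAddCommGroup H] [InnerProductSpace ℂ H]
    [RKHS ℂ H X ℂ] (φ : X → ℂ) : Prop :=
  ∀ f : H, ∃ g : H, ∀ x, g x = φ x * f x

/-- The multiplier algebra of `H`, as the algebra of the multiplication operators `f ↦ φ * f` on
`H`, where `φ` runs through all multipliers. -/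
def multiplierAlgebra (H : Type*) {X : Type*} [NormedAddCommGroup H] [InnerProductSpace ℂ H]
    [RKHS ℂ H X ℂ] : Subalgebra ℂ (H →L[ℂ] H) where
  carrier := {T | ∃ φ : X → ℂ, IsMultiplier H φ ∧ ∀ (f : H) (x : X), T f x = φ x * f x}
  mul_mem' := by
    rintro S T ⟨φ, -, hS⟩ ⟨ψ, -, hT⟩
    have h : ∀ (f : H) (x : X), (S * T) f x = (φ x * ψ x) * f x := fun f x => by
      rw [mul_apply_eq_comp, hS, hT, mul_assoc]
    exact ⟨fun x => φ x * ψ x, fun f => ⟨_, h f⟩, h⟩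
  add_mem' := by
    rintro S T ⟨φ, -, hS⟩ ⟨ψ, -, hT⟩
    have h : ∀ (f : H) (x : X), (S + T) f x = (φ x + ψ x) * f x := fun f x => by
      simp [hS, hT, add_mul]
    exact ⟨fun x => φ x + ψ x, fun f => ⟨_, h f⟩, h⟩
  algebraMap_mem' c := by
    have h : ∀ (f : H) (x : X), (algebraMap ℂ (H →L[ℂ] H) c) f x = c * f x := fun f x => by
      simp [Algebra.algebraMap_eq_smul_one]
    exact ⟨fun _ => c, fun f => ⟨_, h f⟩, h⟩

/-- Every multiplier defines a (bounded) multiplication operator: closed graph theorem. -/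
theorem IsMultiplier.exists_mem_multiplierAlgebra {H X : Type*} [NormedAddCommGroup H]
    [InnerProductSpace ℂ H] [CompleteSpace H] [RKHS ℂ H X ℂ] {φ : X → ℂ} (hφ : IsMultiplier H φ) :
    ∃ T ∈ multiplierAlgebra H, ∀ (f : H) (x : X), T f x = φ x * f x := by
  choose g hg using hφ
  let L : H →ₗ[ℂ] H :=
    { toFun := g
      map_add' := fun f f' => by ext x; simp [hg, mul_add]
      map_smul' := fun c f => by ext x; simp [hg, mul_left_comm] }
  have hL : ∀ (f : H) (x : X), L f x = φ x * f x := hg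
  refine ⟨ContinuousLinearMap.ofSeqClosedGraph (g := L) fun u f f' hu hLu => ?_,
    ⟨φ, fun f => ⟨_, hL f⟩, hL⟩, hL⟩
  ext x
  refine tendsto_nhds_unique (((RKHS.continuous_eval x).tendsto f').comp hLu) ?_
  have := (((RKHS.continuous_eval (𝕜 := ℂ) x).tendsto f).comp hu).const_mul (φ x)
  rw [hL]
  refine this.congr fun n => (hL (u n) x).symm

/-- The operator on `H^{⊕k} = H ⊗ ℂ^k` (the `ℓ²` direct sum) given by a `k × k` matrix of operators
on `H`. -/
def opOfMatrix {H : Type*} [NormedAddCommGroup H] [InnerProductSpace ℂ H] {k : ℕ}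
    (a : Matrix (Fin k) (Fin k) (H →L[ℂ] H)) :
    PiLp 2 (fun _ : Fin k => H) →L[ℂ] PiLp 2 (fun _ : Fin k => H) :=
  (PiLp.continuousLinearEquiv 2 ℂ (fun _ : Fin k => H)).symm.toContinuousLinearMap ∘L
    ContinuousLinearMap.pi fun i => ∑ j, a i j ∘L PiLp.proj 2 (fun _ : Fin k => H) j

@[simp]
theorem opOfMatrix_apply {H : Type*} [NormedAddCommGroup H] [InnerProductSpace ℂ H] {k : ℕ}
    (a : Matrix (Fin k) (Fin k) (H →L[ℂ] H)) (ξ : PiLp 2 (fun _ : Fin k => H)) (i : Fin k) :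
    opOfMatrix a ξ i = ∑ j, a i j (ξ j) := by
  simp [opOfMatrix]

/-- The algebra `M_k(A)` of `k × k` matrices over `A ⊆ B(H)`, acting on `H^{⊕k} = H ⊗ ℂ^k`. -/
def matrixAlgebra {H : Type*} [NormedAddCommGroup H] [InnerProductSpace ℂ H] (k : ℕ)
    (A : Subalgebra ℂ (H →L[ℂ] H)) :
    Subalgebra ℂ (PiLp 2 (fun _ : Fin k => H) →L[ℂ] PiLp 2 (fun _ : Fin k => H)) where
  carrier := {T | ∃ a : Matrix (Fin k) (Fin k) (H →L[ℂ] H), (∀ i j, a i j ∈ A) ∧ T = opOfMatrix a}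
  mul_mem' := by
    rintro _ _ ⟨a, ha, rfl⟩ ⟨b, hb, rfl⟩
    refine ⟨a * b, fun i j => ?_, ?_⟩
    · rw [Matrix.mul_apply]
      exact A.sum_mem fun l _ => A.mul_mem (ha i l) (hb l j)
    · ext ξ i
      simp only [mul_apply_eq_comp, opOfMatrix_apply, Matrix.mul_apply, map_sum,
        sum_apply]
      exact Finset.sum_comm
  add_mem' := by
    rintro _ _ ⟨a, ha, rfl⟩ ⟨b, hb, rfl⟩
    refine ⟨a + b, fun i j => A.add_mem (ha i j) (hb i j), ?_⟩
    ext ξ i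
    simp [Finset.sum_add_distrib]
  algebraMap_mem' c := by
    refine ⟨algebraMap ℂ _ c, fun i j => ?_, ?_⟩
    · rw [Matrix.algebraMap_matrix_apply]
      split_ifs
      · exact A.algebraMap_mem c
      · exact A.zero_mem
    · ext ξ i
      rw [opOfMatrix_apply, Finset.sum_eq_single i]
      · simp [Matrix.algebraMap_matrix_apply, Algebra.algebraMap_eq_smul_one]
      · intro j _ hj
        simp [Matrix.algebraMap_matrix_apply, hj.symm]
      · simp

/-- The weak-* (that is, ultraweak) topology of `B(H)`, the dual of the trace class operators. It is
the coarsest topology for which all functionals `T ↦ ∑ n, ⟨T x_n, y_n⟩` with `∑ ‖x_n‖² < ∞` and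
`∑ ‖y_n‖² < ∞` are continuous; these are the functionals `T ↦ tr (T S)`, `S` of trace class. -/
@[reducible]
def weakStarTopology (H : Type*) [NormedAddCommGroup H] [InnerProductSpace ℂ H] :
    TopologicalSpace (H →L[ℂ] H) :=
  ⨅ (x : ℕ → H) (y : ℕ → H) (_ : Summable fun n => ‖x n‖ ^ 2) (_ : Summable fun n => ‖y n‖ ^ 2),
    TopologicalSpace.induced (fun T : H →L[ℂ] H => ∑' n, inner ℂ (y n) (T (x n))) inferInstance

/-- The functional `φ` on `A ⊆ B(H)` is continuous for the weak-* topology of `B(H)` restricted to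
`A`. -/
def IsWeakStarContinuous {H : Type*} [NormedAddCommGroup H] [InnerProductSpace ℂ H]
    {A : Subalgebra ℂ (H →L[ℂ] H)} (φ : StrongDual ℂ A) : Prop :=
  @Continuous A ℂ ((weakStarTopology H).induced Subtype.val) inferInstance φ

/-- Property `𝔸₁(1)` of an operator algebra `A` acting on `H`. The norm `‖φ‖` is the norm of a
functional on `A` with the operator norm, and `inner ℂ η (T ξ)` is `⟨T ξ, η⟩`, which is linear in
the first variable. -/
def HasA11 {H : Type*} [NormedAddCommGroup H] [InnerProductSpace ℂ H]
    (A : Subalgebra ℂ (H →L[ℂ] H)) : Prop :=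
  ∀ φ : StrongDual ℂ A, IsWeakStarContinuous φ → ‖φ‖ < 1 →
    ∃ ξ η : H, ‖ξ‖ < 1 ∧ ‖η‖ < 1 ∧ ∀ T : A, φ T = inner ℂ η ((T : H →L[ℂ] H) ξ)

end

/-! The column `(z₁, z₂) / √2` of coordinate multiplications on the Drury–Arveson space is
contractive. In an orthonormal basis of monomials, multiplication by `z_i` is a weighted shift with
squared weights `(α_i + 1) / (|α| + 1)`; hence the column is isometric at the constant function `1`,
but on the orthogonal complement of `1` its norm is at most some `r < 1`.

For a column `a` with these properties, consider on the matrix algebra the sum of two copies, in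
disjoint rows and columns, of `c` times the functional reading off `⟨a e, a e⟩`, where `e` is the
unit vector at which `a` is isometric. Its norm is at most `2c`, so for `c < 1 / 2` property `𝔸₁(1)`
gives `x₀, x₁` and `y₀, y₁` with `∑ ‖x_s‖² ≤ 1`, `∑ ‖y_s‖² ≤ 1` and `⟨a x_t, y_s⟩ = c δ_{st}`. These
relations are invariant under simultaneous rotation of the two pairs, so one may assume `x₀ ⊥ e`.
Then `c ≤ r ‖x₀‖ ‖y₀‖` and `c ≤ ‖x₁‖ ‖y₁‖`, whence `c (1 + r) ≤ r`, which fails for `c` close to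
`1 / 2`. -/

noncomputable section

section Rotation

variable {𝕜 : Type*} [RCLike 𝕜]

theorem exists_norm_sq_add_norm_sq_eq_one_and_mul_add_mul_eq_zero (p q : 𝕜) :
    ∃ a b : 𝕜, ‖a‖ ^ 2 + ‖b‖ ^ 2 = 1 ∧ a * p + b * q = 0 := by
  rcases eq_or_ne (‖p‖ ^ 2 + ‖q‖ ^ 2) 0 with hpq | hpq
  · have hp : p = 0 := by simpa using (show ‖p‖ ^ 2 = 0 by nlinarith [sq_nonneg ‖p‖, sq_nonneg ‖q‖])
    have hq : q = 0 := by simpa using (show ‖q‖ ^ 2 = 0 by nlinarith [sq_nonneg ‖p‖, sq_nonneg ‖q‖])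
    exact ⟨1, 0, by simp, by simp [hp, hq]⟩
  · set n : ℝ := √(‖p‖ ^ 2 + ‖q‖ ^ 2)
    have hn2 : n ^ 2 = ‖p‖ ^ 2 + ‖q‖ ^ 2 := Real.sq_sqrt (by positivity)
    refine ⟨q / n, -p / n, ?_, by ring⟩
    rw [norm_div, norm_div, norm_neg, RCLike.norm_ofReal, div_pow, div_pow, sq_abs, hn2, ← add_div,
      add_comm, div_self hpq]

variable {E F : Type*} [NormedAddCommGroup E] [InnerProductSpace 𝕜 E]
  [NormedAddCommGroup F] [InnerProductSpace 𝕜 F]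

theorem norm_sq_add_norm_sq_rotation (a b : 𝕜) (x y : E) :
    ‖a • x + b • y‖ ^ 2 + ‖starRingEnd 𝕜 a • y - starRingEnd 𝕜 b • x‖ ^ 2 =
      (‖a‖ ^ 2 + ‖b‖ ^ 2) * (‖x‖ ^ 2 + ‖y‖ ^ 2) := by
  have hcross : inner 𝕜 (starRingEnd 𝕜 a • y) (starRingEnd 𝕜 b • x) =
      starRingEnd 𝕜 (inner 𝕜 (a • x) (b • y)) := by
    simp only [inner_smul_left, inner_smul_right, map_mul, RCLike.conj_conj, inner_conj_symm]
  rw [@norm_add_sq 𝕜, @norm_sub_sq 𝕜, hcross, RCLike.conj_re]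
  simp only [norm_smul, RCLike.norm_conj]
  ring

theorem inner_rotation_eq {a b : 𝕜} (hab : ‖a‖ ^ 2 + ‖b‖ ^ 2 = 1) (T : E →ₗ[𝕜] F)
    {x₀ x₁ : E} {y₀ y₁ : F} {c : 𝕜} (h₀₀ : inner 𝕜 y₀ (T x₀) = c) (h₁₁ : inner 𝕜 y₁ (T x₁) = c)
    (h₀₁ : inner 𝕜 y₀ (T x₁) = 0) (h₁₀ : inner 𝕜 y₁ (T x₀) = 0) :
    inner 𝕜 (a • y₀ + b • y₁) (T (a • x₀ + b • x₁)) = c := by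
  have hab' : starRingEnd 𝕜 a * a + starRingEnd 𝕜 b * b = 1 := by
    rw [RCLike.conj_mul, RCLike.conj_mul]
    exact_mod_cast hab
  simp only [map_add, map_smul, inner_add_left, inner_add_right, inner_smul_left, inner_smul_right,
    h₀₀, h₁₁, h₀₁, h₁₀, mul_zero, add_zero, zero_add]
  linear_combination c * hab'

theorem mul_one_add_le_of_biorthogonal {T : E →ₗ[𝕜] F} (hT : ∀ f, ‖T f‖ ≤ ‖f‖) {e : E} {r : ℝ}
    (hr : 0 ≤ r) (hTe : ∀ f, inner 𝕜 e f = 0 → ‖T f‖ ≤ r * ‖f‖) {x₀ x₁ : E} {y₀ y₁ : F}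
    (hx : ‖x₀‖ ^ 2 + ‖x₁‖ ^ 2 ≤ 1) (hy : ‖y₀‖ ^ 2 + ‖y₁‖ ^ 2 ≤ 1) {c : 𝕜}
    (h₀₀ : inner 𝕜 y₀ (T x₀) = c) (h₁₁ : inner 𝕜 y₁ (T x₁) = c)
    (h₀₁ : inner 𝕜 y₀ (T x₁) = 0) (h₁₀ : inner 𝕜 y₁ (T x₀) = 0) :
    ‖c‖ * (1 + r) ≤ r := by
  obtain ⟨a, b, hab, hperp⟩ :=
    exists_norm_sq_add_norm_sq_eq_one_and_mul_add_mul_eq_zero (inner 𝕜 e x₀) (inner 𝕜 e x₁)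
  let u := a • x₀ + b • x₁
  let u' := starRingEnd 𝕜 a • x₁ - starRingEnd 𝕜 b • x₀
  let v := a • y₀ + b • y₁
  let v' := starRingEnd 𝕜 a • y₁ - starRingEnd 𝕜 b • y₀
  have hu : ‖u‖ ^ 2 + ‖u'‖ ^ 2 ≤ 1 := by rwa [norm_sq_add_norm_sq_rotation, hab, one_mul]
  have hv : ‖v‖ ^ 2 + ‖v'‖ ^ 2 ≤ 1 := by rwa [norm_sq_add_norm_sq_rotation, hab, one_mul]
  have hc : ‖c‖ ≤ ‖v‖ * (r * ‖u‖) := by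
    rw [← inner_rotation_eq hab T h₀₀ h₁₁ h₀₁ h₁₀]
    refine (norm_inner_le_norm _ _).trans (mul_le_mul_of_nonneg_left (hTe _ ?_) (norm_nonneg _))
    rw [inner_add_right, inner_smul_right, inner_smul_right, hperp]
  have hc' : ‖c‖ ≤ ‖v'‖ * ‖u'‖ := by
    have h := inner_rotation_eq (a := starRingEnd 𝕜 a) (b := -starRingEnd 𝕜 b)
      (by simpa using hab) T h₁₁ h₀₀ h₁₀ h₀₁
    simp only [neg_smul, ← sub_eq_add_neg] at h
    rw [← h]
    exact (norm_inner_le_norm _ _).trans (mul_le_mul_of_nonneg_left (hT _) (norm_nonneg _))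
  have hsum : ‖v‖ * ‖u‖ + ‖v'‖ * ‖u'‖ ≤ 1 := by
    linarith [two_mul_le_add_sq ‖v‖ ‖u‖, two_mul_le_add_sq ‖v'‖ ‖u'‖]
  calc ‖c‖ * (1 + r) ≤ ‖v‖ * (r * ‖u‖) + r * (‖v'‖ * ‖u'‖) := by
        linarith [mul_le_mul_of_nonneg_left hc' hr]
    _ = r * (‖v‖ * ‖u‖ + ‖v'‖ * ‖u'‖) := by ring
    _ ≤ r := mul_le_of_le_one_right hr hsum

end Rotation

section PiLp

variable {E : Type*} [SeminormedAddCommGroup E] {ι κ : Type*} [Fintype ι] [Fintype κ] {σ : ι → κ}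

theorem sum_norm_sq_comp_le (hσ : Function.Injective σ) (ζ : PiLp 2 fun _ : κ => E) :
    ∑ i, ‖ζ (σ i)‖ ^ 2 ≤ ‖ζ‖ ^ 2 := by
  classical
  rw [PiLp.norm_sq_eq_of_L2, ← Finset.sum_image (f := fun j => ‖ζ j‖ ^ 2) hσ.injOn]
  exact Finset.sum_le_univ_sum_of_nonneg fun j => by positivity

theorem norm_toLp_extend (hσ : Function.Injective σ) (v : PiLp 2 fun _ : ι => E) :
    ‖WithLp.toLp 2 (Function.extend σ v 0)‖ = ‖v‖ := by
  rw [PiLp.norm_eq_of_L2, PiLp.norm_eq_of_L2]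
  congr 1
  refine (Fintype.sum_of_injective σ hσ _ _ (fun j hj => ?_) fun i => ?_).symm
  · rw [PiLp.toLp_apply, Function.extend_apply' _ _ _ hj, Pi.zero_apply, norm_zero, sq, zero_mul]
  · exact congrArg (‖·‖ ^ 2) (hσ.extend_apply v 0 i).symm

end PiLp

theorem extend_prodMk_apply {ι κ X M : Type*} [DecidableEq κ] [Zero M] {row : κ × ι → X}
    (hrow : Function.Injective row) (v : ι → M) (s t : κ) (i : ι) :
    Function.extend (fun i => row (t, i)) v 0 (row (s, i)) = if s = t then v i else 0 := by
  split_ifs with hst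
  · subst hst
    exact (hrow.comp (Prod.mk_right_injective s)).extend_apply v 0 i
  · refine Function.extend_apply' _ (0 : X → M) _ ?_
    rintro ⟨j, hj⟩
    exact hst (congrArg Prod.fst (hrow hj)).symm

section MatrixAlgebra

variable {H : Type*} [NormedAddCommGroup H] [InnerProductSpace ℂ H] {A : Subalgebra ℂ (H →L[ℂ] H)}

theorem isWeakStarContinuous_of_eq_tsum_inner {ι : Type*} [Countable ι] {x y : ι → H}
    (hx : Summable fun i => ‖x i‖ ^ 2) (hy : Summable fun i => ‖y i‖ ^ 2) {φ : StrongDual ℂ A}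
    (hφ : ∀ T : A, φ T = ∑' i, inner ℂ (y i) ((T : H →L[ℂ] H) (x i))) :
    IsWeakStarContinuous φ := by
  obtain ⟨e, he⟩ := exists_injective_nat ι
  let x' : ℕ → H := Function.extend e x 0
  let y' : ℕ → H := Function.extend e y 0
  have extend_eq_zero (v : ι → H) {n : ℕ} (hn : n ∉ Set.range e) : Function.extend e v 0 n = 0 :=
    Function.extend_apply' v (0 : ℕ → H) n hn
  have summable_extend (v : ι → H) (hv : Summable fun i => ‖v i‖ ^ 2) :
      Summable fun n => ‖Function.extend e v 0 n‖ ^ 2 := by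
    rw [← he.summable_iff fun n hn => by rw [extend_eq_zero v hn, norm_zero, sq, zero_mul]]
    simpa only [Function.comp_def, he.extend_apply] using hv
  have tsum_inner (T : H →L[ℂ] H) :
      ∑' n, inner ℂ (y' n) (T (x' n)) = ∑' i, inner ℂ (y i) (T (x i)) := by
    rw [← he.tsum_eq (Function.support_subset_iff'.2 fun n hn => by
      rw [show x' n = 0 from extend_eq_zero x hn, map_zero, inner_zero_right])]
    simp only [x', y', he.extend_apply]
  have hle : weakStarTopology H ≤ TopologicalSpace.induced
      (fun T : H →L[ℂ] H => ∑' n, inner ℂ (y' n) (T (x' n))) inferInstance :=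
    iInf_le_of_le x' <| iInf_le_of_le y' <| iInf_le_of_le (summable_extend x hx) <|
      iInf_le_of_le (summable_extend y hy) le_rfl
  rw [IsWeakStarContinuous, continuous_iff_le_induced]
  refine (induced_mono hle).trans_eq ?_
  rw [induced_compose]
  congr 1
  funext T
  rw [Function.comp_apply, tsum_inner, hφ]

theorem HasA11.exists_inner_eq_sum_inner (hA : HasA11 A) {ι : Type*} [Fintype ι] (x y : ι → H)
    (hxy : ∑ i, ‖y i‖ * ‖x i‖ < 1) :
    ∃ ξ η : H, ‖ξ‖ < 1 ∧ ‖η‖ < 1 ∧ ∀ T ∈ A, inner ℂ η (T ξ) = ∑ i, inner ℂ (y i) (T (x i)) := by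
  let L : A →ₗ[ℂ] ℂ :=
    { toFun := fun T => ∑ i, inner ℂ (y i) ((T : H →L[ℂ] H) (x i))
      map_add' := fun S T => by simp [Finset.sum_add_distrib]
      map_smul' := fun c T => by simp [Finset.mul_sum] }
  have hL (T : A) : ‖L T‖ ≤ (∑ i, ‖y i‖ * ‖x i‖) * ‖T‖ := by
    rw [Finset.sum_mul]
    refine norm_sum_le_of_le _ fun i _ => (norm_inner_le_norm _ _).trans ?_
    rw [mul_assoc, mul_comm ‖x i‖]
    exact mul_le_mul_of_nonneg_left ((T : H →L[ℂ] H).le_opNorm (x i)) (norm_nonneg _)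
  obtain ⟨ξ, η, hξ, hη, h⟩ := hA (L.mkContinuous _ hL)
    (isWeakStarContinuous_of_eq_tsum_inner (.of_finite (f := fun i => ‖x i‖ ^ 2))
      (.of_finite (f := fun i => ‖y i‖ ^ 2)) fun T => (tsum_fintype _).symm)
    ((L.mkContinuous_norm_le (by positivity) hL).trans_lt hxy)
  exact ⟨ξ, η, hξ, hη, fun T hT => (h ⟨T, hT⟩).symm⟩

variable {ι : Type*}

/-- The column operator `f ↦ (a i f)_i` from `H` to `H^{⊕ι}` with entries `a i`. -/
def column (a : ι → H →L[ℂ] H) : H →ₗ[ℂ] PiLp 2 fun _ : ι => H :=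
  (WithLp.linearEquiv 2 ℂ (ι → H)).symm.toLinearMap ∘ₗ LinearMap.pi fun i => (a i).toLinearMap

@[simp]
theorem column_apply (a : ι → H →L[ℂ] H) (f : H) (i : ι) : column a f i = a i f := rfl

variable [Fintype ι]

theorem norm_sq_column_apply (a : ι → H →L[ℂ] H) (f : H) :
    ‖column a f‖ ^ 2 = ∑ i, ‖a i f‖ ^ 2 := by
  simp only [PiLp.norm_sq_eq_of_L2, column_apply]

variable {k : ℕ} {κ : Type*} [Fintype κ] [DecidableEq κ]

theorem opOfMatrix_single_mem (i j : Fin k) {a : H →L[ℂ] H} (ha : a ∈ A) :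
    opOfMatrix (Matrix.single i j a) ∈ matrixAlgebra k A := by
  refine ⟨_, fun i' j' => ?_, rfl⟩
  rw [Matrix.single_apply]
  split_ifs
  · exact ha
  · exact A.zero_mem

theorem inner_opOfMatrix_single (i j : Fin k) (a : H →L[ℂ] H) (ξ ζ : PiLp 2 fun _ : Fin k => H) :
    inner ℂ ζ (opOfMatrix (Matrix.single i j a) ξ) = inner ℂ (ζ i) (a (ξ j)) := by
  rw [PiLp.inner_apply, Finset.sum_eq_single_of_mem i (Finset.mem_univ i), opOfMatrix_apply,
    Finset.sum_eq_single_of_mem j (Finset.mem_univ j), Matrix.single_apply_same]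
  · intro j' _ hj
    rw [Matrix.single_apply_of_col_ne _ _ hj.symm, zero_apply]
  · intro i' _ hi
    rw [opOfMatrix_apply, Finset.sum_eq_zero fun j' _ => ?_, inner_zero_right]
    rw [Matrix.single_apply_of_row_ne hi.symm, zero_apply]

theorem HasA11.exists_inner_apply_eq_sum_inner (hA : HasA11 (matrixAlgebra k A)) {ι : Type*}
    [Fintype ι] (x y : ι → PiLp 2 fun _ : Fin k => H) (hxy : ∑ s, ‖y s‖ * ‖x s‖ < 1) :
    ∃ ξ η : PiLp 2 fun _ : Fin k => H, ‖ξ‖ < 1 ∧ ‖η‖ < 1 ∧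
      ∀ i j, ∀ a ∈ A, inner ℂ (η i) (a (ξ j)) = ∑ s, inner ℂ (y s i) (a (x s j)) := by
  obtain ⟨ξ, η, hξ, hη, h⟩ := hA.exists_inner_eq_sum_inner x y hxy
  refine ⟨ξ, η, hξ, hη, fun i j a ha => ?_⟩
  simpa only [inner_opOfMatrix_single] using h _ (opOfMatrix_single_mem i j ha)

theorem HasA11.exists_inner_apply_eq_ite (hA : HasA11 (matrixAlgebra k A))
    {row : κ × ι → Fin k} (hrow : Function.Injective row) {col : κ → Fin k}
    (hcol : Function.Injective col) (e : H) (w : PiLp 2 fun _ : ι => H)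
    (hwe : Fintype.card κ * (‖w‖ * ‖e‖) < 1) :
    ∃ ξ η : PiLp 2 fun _ : Fin k => H, ‖ξ‖ < 1 ∧ ‖η‖ < 1 ∧ ∀ s t i, ∀ a ∈ A,
      inner ℂ (η (row (s, i))) (a (ξ (col t))) = if s = t then inner ℂ (w i) (a e) else 0 := by
  let x (t : κ) : PiLp 2 fun _ : Fin k => H := PiLp.single 2 (col t) e
  let y (t : κ) : PiLp 2 fun _ : Fin k => H :=
    WithLp.toLp 2 (Function.extend (fun i => row (t, i)) w 0)
  have norm_y (t : κ) : ‖y t‖ = ‖w‖ :=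
    norm_toLp_extend (hrow.comp (Prod.mk_right_injective t)) w
  obtain ⟨ξ, η, hξ, hη, h⟩ := hA.exists_inner_apply_eq_sum_inner x y (by simpa [x, norm_y])
  refine ⟨ξ, η, hξ, hη, fun s t i a ha => ?_⟩
  have x_col (s : κ) : x s (col t) = if s = t then e else 0 := by
    simp only [x, PiLp.single_apply, hcol.eq_iff, eq_comm]
  have y_row : y t (row (s, i)) = if s = t then w i else 0 :=
    extend_prodMk_apply hrow w s t i
  rw [h _ _ a ha, Finset.sum_eq_single_of_mem t (Finset.mem_univ t) fun s' _ hs => ?_]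
  · rw [x_col, if_pos rfl, y_row]
    split_ifs
    · rfl
    · exact inner_zero_left _
  · rw [x_col, if_neg hs, map_zero, inner_zero_right]

theorem HasA11.exists_biorthogonal (hA : HasA11 (matrixAlgebra k A)) [Nonempty ι]
    (hk : Fintype.card κ * Fintype.card ι ≤ k) {a : ι → H →L[ℂ] H} (ha : ∀ i, a i ∈ A)
    {e : H} (he : ‖e‖ = 1) (hae : ‖column a e‖ = 1) {c : ℝ} (hc : 0 ≤ c)
    (hcκ : Fintype.card κ * c < 1) :
    ∃ (x : κ → H) (y : κ → PiLp 2 fun _ : ι => H), ∑ s, ‖x s‖ ^ 2 ≤ 1 ∧ ∑ s, ‖y s‖ ^ 2 ≤ 1 ∧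
      ∀ s t, inner ℂ (y s) (column a (x t)) = if s = t then (c : ℂ) else 0 := by
  obtain ⟨row⟩ : Nonempty (κ × ι ↪ Fin k) := Function.Embedding.nonempty_of_card_le (by simpa)
  let col (s : κ) : Fin k := row (s, Classical.arbitrary ι)
  have hcol : Function.Injective col := fun s t h => congrArg Prod.fst (row.injective h)
  obtain ⟨ξ, η, hξ, hη, h⟩ := hA.exists_inner_apply_eq_ite row.injective hcol e
    ((c : ℂ) • column a e) (by simpa [norm_smul, hae, he, abs_of_nonneg hc] using hcκ)
  refine ⟨fun t => ξ (col t), fun s => WithLp.toLp 2 fun i => η (row (s, i)),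
    (sum_norm_sq_comp_le hcol ξ).trans (pow_le_one₀ (norm_nonneg _) hξ.le), ?_, fun s t => ?_⟩
  · simp only [PiLp.norm_sq_eq_of_L2, ← Fintype.sum_prod_type']
    exact (sum_norm_sq_comp_le row.injective η).trans (pow_le_one₀ (norm_nonneg _) hη.le)
  · have hinner (i : ι) := h s t i (a i) (ha i)
    calc inner ℂ (WithLp.toLp 2 fun i => η (row (s, i))) (column a (ξ (col t)))
        = ∑ i, if s = t then inner ℂ (((c : ℂ) • column a e) i) (a i e) else 0 := by
          simp only [PiLp.inner_apply, column_apply, hinner]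
      _ = if s = t then inner ℂ ((c : ℂ) • column a e) (column a e) else 0 := by
          split_ifs
          · rw [PiLp.inner_apply]
            rfl
          · exact Finset.sum_const_zero
      _ = if s = t then (c : ℂ) else 0 := by
          rw [inner_smul_left, inner_self_eq_norm_sq_to_K, hae, Complex.conj_ofReal]
          simp

theorem not_hasA11_matrixAlgebra (hk : 2 * Fintype.card ι ≤ k) {a : ι → H →L[ℂ] H}
    (ha : ∀ i, a i ∈ A) {e : H} (he : ‖e‖ = 1) (hae : ‖column a e‖ = 1)
    (hle : ∀ f, ‖column a f‖ ≤ ‖f‖) {r : ℝ} (hr₀ : 0 ≤ r) (hr₁ : r < 1)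
    (hr : ∀ f, inner ℂ e f = 0 → ‖column a f‖ ≤ r * ‖f‖) : ¬ HasA11 (matrixAlgebra k A) := by
  intro hA
  have : Nonempty ι := by
    by_contra! h
    simpa [hae] using norm_sq_column_apply a e
  obtain ⟨c, hrc, hc⟩ : ∃ c, r / (1 + r) < c ∧ c < 1 / 2 :=
    exists_between (by rw [div_lt_div_iff₀ (by positivity) two_pos]; linarith)
  have hc₀ : 0 ≤ c := (by positivity : 0 ≤ r / (1 + r)).trans hrc.le
  obtain ⟨x, y, hx, hy, hxy⟩ := hA.exists_biorthogonal (κ := Fin 2) (by simpa using hk) ha he hae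
    hc₀ (by simp only [Fintype.card_fin, Nat.cast_ofNat]; linarith)
  rw [Fin.sum_univ_two] at hx hy
  have h := mul_one_add_le_of_biorthogonal hle hr₀ hr hx hy (hxy 0 0) (hxy 1 1) (hxy 0 1) (hxy 1 0)
  rw [if_pos rfl, Complex.norm_of_nonneg hc₀, ← le_div_iff₀ (by positivity)] at h
  exact hrc.not_ge h

end MatrixAlgebra

section Multinomial

variable {𝕜 ι : Type*} [RCLike 𝕜] [Fintype ι]

theorem preimage_sum_singleton [DecidableEq ι] (n : ℕ) :
    (fun α : ι → ℕ => ∑ i, α i) ⁻¹' {n} = (Finset.univ.piAntidiag n : Finset (ι → ℕ)) := by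
  ext α
  simp

theorem tsum_multinomial_mul_prod_pow_of_sum_eq (a : ι → 𝕜) (n : ℕ) :
    ∑' α : (fun α : ι → ℕ => ∑ i, α i) ⁻¹' {n},
      (Nat.multinomial Finset.univ α.1 : 𝕜) * ∏ i, a i ^ α.1 i = (∑ i, a i) ^ n := by
  classical
  rw [preimage_sum_singleton, Finset.sum_pow_eq_sum_piAntidiag]
  exact Finset.tsum_subtype' _ fun α => (Nat.multinomial Finset.univ α : 𝕜) * ∏ i, a i ^ α i

theorem summable_multinomial_mul_prod_pow {a : ι → 𝕜} (ha : ∑ i, ‖a i‖ < 1) :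
    Summable fun α : ι → ℕ => (Nat.multinomial Finset.univ α : 𝕜) * ∏ i, a i ^ α i := by
  classical
  refine .of_norm ((summable_partition (fun α => norm_nonneg _)
    (s := fun n => (fun α : ι → ℕ => ∑ i, α i) ⁻¹' {n}) fun α => ?_).2 ⟨fun n => ?_, ?_⟩)
  · exact ⟨_, rfl, fun n hn => hn.symm⟩
  · rw [preimage_sum_singleton]
    exact .of_finite
  · simpa [tsum_multinomial_mul_prod_pow_of_sum_eq fun i => ‖a i‖] using
      summable_geometric_of_lt_one (by positivity) ha

theorem hasSum_multinomial_mul_prod_pow {a : ι → 𝕜} (ha : ∑ i, ‖a i‖ < 1) :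
    HasSum (fun α : ι → ℕ => (Nat.multinomial Finset.univ α : 𝕜) * ∏ i, a i ^ α i)
      (1 - ∑ i, a i)⁻¹ := by
  have hsummable := summable_multinomial_mul_prod_pow ha
  have hfib := hsummable.hasSum.tsum_fiberwise fun α => ∑ i, α i
  simp only [tsum_multinomial_mul_prod_pow_of_sum_eq] at hfib
  rw [← hfib.unique (hasSum_geometric_of_norm_lt_one ((norm_sum_le _ _).trans_lt ha))]
  exact hsummable.hasSum

theorem multinomial_add_single_mul [DecidableEq ι] (α : ι → ℕ) (i : ι) :
    Nat.multinomial Finset.univ (α + Pi.single i 1) * (α i + 1) =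
      Nat.multinomial Finset.univ α * (∑ j, α j + 1) := by
  have h := Nat.multinomial_spec Finset.univ α
  have h' := Nat.multinomial_spec Finset.univ (α + Pi.single i 1)
  have hsum : ∑ j, (α + Pi.single i 1 : ι → ℕ) j = ∑ j, α j + 1 := by
    simp [Finset.sum_add_distrib]
  have hprod : ∏ j, ((α + Pi.single i 1 : ι → ℕ) j).factorial =
      (α i + 1) * ∏ j, (α j).factorial := by
    rw [← Finset.mul_prod_erase _ _ (Finset.mem_univ i),
      ← Finset.mul_prod_erase _ (fun j => (α j).factorial) (Finset.mem_univ i), ← mul_assoc]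
    congr 1
    · simp [Nat.factorial_succ]
    · refine Finset.prod_congr rfl fun j hj => ?_
      simp [Finset.ne_of_mem_erase hj]
  rw [hsum, hprod, Nat.factorial_succ, ← h] at h'
  have hpos : 0 < ∏ j, (α j).factorial := Finset.prod_pos fun j _ => Nat.factorial_pos _
  refine Nat.eq_of_mul_eq_mul_left hpos ?_
  linarith

end Multinomial

section WeightedPullback

variable {𝕜 ι κ : Type*} [RCLike 𝕜]

theorem hasSum_norm_sq_lp (g : lp (fun _ : ι => 𝕜) 2) :
    HasSum (fun i => ‖g i‖ ^ 2) (‖g‖ ^ 2) := by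
  simpa using lp.hasSum_norm (p := 2) (by norm_num) g

theorem norm_sq_mul_comp_le {τ : ι → κ} {w : ι → 𝕜} (hw : ∀ i, ‖w i‖ ≤ 1) (g : κ → 𝕜) (i : ι) :
    ‖w i * g (τ i)‖ ^ 2 ≤ ‖g (τ i)‖ ^ 2 := by
  rw [norm_mul]
  exact pow_le_pow_left₀ (by positivity) (mul_le_of_le_one_left (norm_nonneg _) (hw i)) 2

theorem memℓp_mul_comp {τ : ι → κ} (hτ : Function.Injective τ) {w : ι → 𝕜} (hw : ∀ i, ‖w i‖ ≤ 1)
    (g : lp (fun _ : κ => 𝕜) 2) : Memℓp (fun i => w i * g (τ i)) 2 := by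
  refine memℓp_gen ?_
  simp only [ENNReal.toReal_ofNat, Real.rpow_ofNat]
  exact .of_nonneg_of_le (fun i => sq_nonneg _) (norm_sq_mul_comp_le hw g)
    ((hasSum_norm_sq_lp g).summable.comp_injective hτ)

/-- The weighted composition operator `g ↦ w * (g ∘ τ)` on `ℓ²`, whose adjoint is the weighted shift
sending the basis vector at `i` to a multiple of the one at `τ i`. -/
def weightedPullback (τ : ι → κ) (hτ : Function.Injective τ) (w : ι → 𝕜) (hw : ∀ i, ‖w i‖ ≤ 1) :
    lp (fun _ : κ => 𝕜) 2 →L[𝕜] lp (fun _ : ι => 𝕜) 2 :=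
  LinearMap.mkContinuous
    { toFun := fun g => ⟨fun i => w i * g (τ i), memℓp_mul_comp hτ hw g⟩
      map_add' := fun f g => lp.ext <| funext fun i => mul_add (w i) (f (τ i)) (g (τ i))
      map_smul' := fun c g => lp.ext <| funext fun i => mul_left_comm (w i) c (g (τ i)) } 1
    fun g => by
      refine (one_mul ‖g‖).symm ▸ le_of_sq_le_sq ?_ (norm_nonneg _)
      exact hasSum_le_inj τ hτ (fun k _ => sq_nonneg ‖g k‖) (norm_sq_mul_comp_le hw g)
        (hasSum_norm_sq_lp ⟨fun i => w i * g (τ i), memℓp_mul_comp hτ hw g⟩) (hasSum_norm_sq_lp g)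

variable {τ : ι → κ} (hτ : Function.Injective τ) {w : ι → 𝕜} (hw : ∀ i, ‖w i‖ ≤ 1)

@[simp]
theorem weightedPullback_apply (g : lp (fun _ : κ => 𝕜) 2) (i : ι) :
    weightedPullback τ hτ w hw g i = w i * g (τ i) := rfl

theorem adjoint_weightedPullback_apply (g : lp (fun _ : ι => 𝕜) 2) (i : ι) :
    (weightedPullback τ hτ w hw).adjoint g (τ i) = starRingEnd 𝕜 (w i) * g i := by
  classical
  have h : weightedPullback τ hτ w hw (lp.single 2 (τ i) 1) = lp.single 2 i (w i) := by
    ext j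
    obtain rfl | hji := eq_or_ne j i
    · simp
    · simp [lp.single_apply, Pi.single_eq_of_ne hji, Pi.single_eq_of_ne (hτ.ne hji)]
  have h' := (weightedPullback τ hτ w hw).adjoint_inner_right (lp.single 2 (τ i) 1) g
  rw [h, lp.inner_single_left, lp.inner_single_left] at h'
  simpa [mul_comm] using h'

theorem hasSum_norm_sq_adjoint_weightedPullback (g : lp (fun _ : ι => 𝕜) 2) :
    HasSum (fun i => ‖w i‖ ^ 2 * ‖g i‖ ^ 2) (‖(weightedPullback τ hτ w hw).adjoint g‖ ^ 2) := by
  let S := (weightedPullback τ hτ w hw).adjoint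
  have h := lp.hasSum_inner (𝕜 := 𝕜) (weightedPullback τ hτ w hw (S g)) g
  rw [← ContinuousLinearMap.adjoint_inner_right, inner_self_eq_norm_sq_to_K] at h
  have hterm (i : ι) : inner 𝕜 (weightedPullback τ hτ w hw (S g) i) (g i) =
      ((‖w i‖ ^ 2 * ‖g i‖ ^ 2 : ℝ) : 𝕜) := by
    rw [weightedPullback_apply, adjoint_weightedPullback_apply, ← mul_assoc, RCLike.mul_conj,
      RCLike.inner_apply, map_mul, mul_left_comm, RCLike.mul_conj]
    simp
  simp only [hterm] at h
  exact_mod_cast h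

end WeightedPullback

section Isometry

variable {𝕜 E F : Type*} [RCLike 𝕜] [NormedAddCommGroup E] [InnerProductSpace 𝕜 E]
  [NormedAddCommGroup F] [InnerProductSpace 𝕜 F] [CompleteSpace F]

theorem exists_linearIsometry_of_inner_eq {X : Type*}
    {v : X → E} {w : X → F} (hv : Dense (Submodule.span 𝕜 (Set.range v) : Set E))
    (h : ∀ x y, inner 𝕜 (v x) (v y) = inner 𝕜 (w x) (w y)) :
    ∃ U : E →ₗᵢ[𝕜] F, ∀ x, U (v x) = w x := by
  let e : (X →₀ 𝕜) →ₗ[𝕜] E := Finsupp.linearCombination 𝕜 v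
  let f : (X →₀ 𝕜) →ₗ[𝕜] F := Finsupp.linearCombination 𝕜 w
  have he : DenseRange e := by
    rw [DenseRange, ← LinearMap.coe_range, Finsupp.range_linearCombination]
    exact hv
  have hinner (a b : X →₀ 𝕜) : inner 𝕜 (f a) (f b) = inner 𝕜 (e a) (e b) := by
    simp only [e, f, Finsupp.linearCombination_apply, Finsupp.sum, inner_sum, sum_inner,
      inner_smul_left, inner_smul_right, h]
  have hnorm (a : X →₀ 𝕜) : ‖f a‖ = ‖e a‖ := by
    rw [@norm_eq_sqrt_re_inner 𝕜, hinner, ← @norm_eq_sqrt_re_inner 𝕜]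
  have hext := LinearMap.extendOfNorm_eq he ⟨1, fun a => (hnorm a).le.trans_eq (one_mul _).symm⟩
  refine ⟨⟨(f.extendOfNorm e).toLinearMap, fun u => ?_⟩, fun x => ?_⟩
  · refine congrFun (he.equalizer (g := fun u => ‖f.extendOfNorm e u‖) (h := fun u => ‖u‖)
      (by fun_prop) continuous_norm (funext fun a => ?_)) u
    simp [hext, hnorm]
  · simpa [e, f] using hext (Finsupp.single x 1)

theorem norm_adjoint_toContinuousLinearMap_le [CompleteSpace E] (U : E →ₗᵢ[𝕜] F) (g : F) :
    ‖U.toContinuousLinearMap.adjoint g‖ ≤ ‖g‖ := by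
  refine (ContinuousLinearMap.le_opNorm _ _).trans (mul_le_of_le_one_left (norm_nonneg _) ?_)
  rw [LinearIsometryEquiv.norm_map]
  exact U.norm_toContinuousLinearMap_le

end Isometry

section ReproducingKernel

variable {𝕜 H X : Type*} [RCLike 𝕜] [NormedAddCommGroup H] [InnerProductSpace 𝕜 H]
  [CompleteSpace H] [RKHS 𝕜 H X 𝕜]

theorem inner_kerFun_one (x : X) (f : H) : inner 𝕜 (RKHS.kerFun H x (1 : 𝕜)) f = f x := by
  simp [RKHS.kerFun_inner]

variable (𝕜 H) in
theorem dense_span_kerFun_one :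
    Dense (Submodule.span 𝕜 (Set.range fun x : X => RKHS.kerFun H x (1 : 𝕜)) : Set H) := by
  rw [Submodule.dense_iff_topologicalClosure_eq_top, eq_top_iff, ← RKHS.kerFun_dense H]
  refine Submodule.topologicalClosure_mono (Submodule.span_le.2 ?_)
  rintro _ ⟨x, c, rfl⟩
  have hsmul : RKHS.kerFun H x c = c • RKHS.kerFun H x (1 : 𝕜) := by
    rw [← map_smul, smul_eq_mul, mul_one]
  rw [hsmul]
  exact Submodule.smul_mem _ _ (Submodule.subset_span ⟨x, rfl⟩)

end ReproducingKernel

section MonomialSpace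

variable {d : ℕ}

theorem sum_norm_mul_norm_le {𝕜 ι : Type*} [RCLike 𝕜] [Fintype ι] (z w : EuclideanSpace 𝕜 ι) :
    ∑ i, ‖z i‖ * ‖w i‖ ≤ ‖z‖ * ‖w‖ := by
  rw [EuclideanSpace.norm_eq, EuclideanSpace.norm_eq]
  exact Real.sum_mul_le_sqrt_mul_sqrt _ _ _

theorem sum_norm_mul_norm_lt_one (z w : UnitBall d) : ∑ i, ‖z.1 i‖ * ‖w.1 i‖ < 1 :=
  (sum_norm_mul_norm_le z.1 w.1).trans_lt <| mul_lt_one_of_nonneg_of_lt_one_left (norm_nonneg _)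
    (mem_ball_zero_iff.1 z.2) (mem_ball_zero_iff.1 w.2).le

/-- The space `ℓ²(ℕ^d)` of coefficients of functions in the Drury–Arveson space with respect to
the normalized monomials `√(|α|! / α!) z ^ α`. -/
abbrev MonomialSpace (d : ℕ) : Type := lp (fun _ : Fin d → ℕ => ℂ) 2

/-- The coefficients of the reproducing kernel at `w` with respect to the normalized monomials. -/
def monomialKernel (w : UnitBall d) : MonomialSpace d :=
  ⟨fun α => √(Nat.multinomial Finset.univ α) * starRingEnd ℂ (∏ i, w.1 i ^ α i), memℓp_gen <| by
    have h := summable_multinomial_mul_prod_pow (𝕜 := ℝ) (a := fun i => ‖w.1 i‖ * ‖w.1 i‖)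
      (by simpa using sum_norm_mul_norm_lt_one w w)
    refine h.congr fun α => ?_
    simp only [mul_pow, Finset.prod_mul_distrib]
    simp [mul_pow, ← sq]⟩

theorem monomialKernel_apply (w : UnitBall d) (α : Fin d → ℕ) : monomialKernel w α =
    √(Nat.multinomial Finset.univ α) * starRingEnd ℂ (∏ i, w.1 i ^ α i) := rfl

theorem inner_monomialKernel (z w : UnitBall d) :
    inner ℂ (monomialKernel z) (monomialKernel w) = (1 - inner ℂ w.1 z.1)⁻¹ := by
  have h := hasSum_multinomial_mul_prod_pow (a := fun i => z.1 i * starRingEnd ℂ (w.1 i))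
    (by simpa using sum_norm_mul_norm_lt_one z w)
  rw [PiLp.inner_apply]
  simp only [RCLike.inner_apply]
  refine (lp.hasSum_inner (𝕜 := ℂ) (monomialKernel z) (monomialKernel w)).unique
    (h.congr_fun fun α => ?_)
  have hsqrt : ((√(Nat.multinomial Finset.univ α) : ℝ) : ℂ) * √(Nat.multinomial Finset.univ α) =
      Nat.multinomial Finset.univ α := by
    rw [← Complex.ofReal_mul, Real.mul_self_sqrt (Nat.cast_nonneg _), Complex.ofReal_natCast]
  simp only [monomialKernel_apply, RCLike.inner_apply, map_mul, Complex.conj_conj,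
    Complex.conj_ofReal, mul_pow, Finset.prod_mul_distrib, map_prod, map_pow, ← hsqrt]
  ring

theorem inner_kerFun_druryArveson (z w : UnitBall d) :
    inner ℂ (RKHS.kerFun (DruryArveson d) z 1) (RKHS.kerFun (DruryArveson d) w 1) =
      (1 - inner ℂ w.1 z.1)⁻¹ := by
  rw [RKHS.kerFun_inner, RKHS.kerFun_apply, kernel_druryArveson]
  simp [druryArvesonKernel]

theorem exists_linearIsometry_monomialKernel (d : ℕ) : ∃ U : DruryArveson d →ₗᵢ[ℂ] MonomialSpace d,
    ∀ w, U (RKHS.kerFun (DruryArveson d) w 1) = monomialKernel w :=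
  exists_linearIsometry_of_inner_eq (dense_span_kerFun_one ℂ (DruryArveson d)) fun z w => by
    rw [inner_kerFun_druryArveson, inner_monomialKernel]

/-- The isometry sending a function to its coefficients with respect to the normalized monomials,
pinned down by its values on the reproducing kernels. -/
def monomialEmbedding (d : ℕ) : DruryArveson d →ₗᵢ[ℂ] MonomialSpace d :=
  (exists_linearIsometry_monomialKernel d).choose

@[simp]
theorem monomialEmbedding_kerFun_one (w : UnitBall d) :
    monomialEmbedding d (RKHS.kerFun (DruryArveson d) w 1) = monomialKernel w :=
  (exists_linearIsometry_monomialKernel d).choose_spec w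

theorem inner_monomialKernel_monomialEmbedding (w : UnitBall d) (f : DruryArveson d) :
    inner ℂ (monomialKernel w) (monomialEmbedding d f) = f w := by
  rw [← monomialEmbedding_kerFun_one, LinearIsometry.inner_map_map, inner_kerFun_one]

end MonomialSpace

section CoordMul

variable {d : ℕ}

/-- The ratio of the norms of `z_i z ^ α` and `z ^ α` in the Drury–Arveson space. -/
def shiftWeight (i : Fin d) (α : Fin d → ℕ) : ℂ := √((α i + 1) / ((∑ j, α j : ℕ) + 1))

theorem norm_sq_shiftWeight (i : Fin d) (α : Fin d → ℕ) :
    ‖shiftWeight i α‖ ^ 2 = (α i + 1) / ((∑ j, α j : ℕ) + 1) := by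
  rw [shiftWeight, Complex.norm_real, Real.norm_of_nonneg (Real.sqrt_nonneg _),
    Real.sq_sqrt (by positivity)]

theorem norm_shiftWeight_le_one (i : Fin d) (α : Fin d → ℕ) : ‖shiftWeight i α‖ ≤ 1 := by
  have h : α i ≤ ∑ j, α j := Finset.single_le_sum (fun j _ => Nat.zero_le _) (Finset.mem_univ i)
  rw [← sq_le_one_iff₀ (norm_nonneg _), norm_sq_shiftWeight, div_le_one (by positivity)]
  exact_mod_cast Nat.add_le_add_right h 1

/-- The adjoint of multiplication by `z_i`, in terms of coefficients. -/
def coordPullback (i : Fin d) : MonomialSpace d →L[ℂ] MonomialSpace d :=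
  weightedPullback (· + Pi.single i 1) (add_left_injective _) (shiftWeight i)
    (norm_shiftWeight_le_one i)

theorem shiftWeight_mul_sqrt_multinomial (i : Fin d) (α : Fin d → ℕ) :
    shiftWeight i α * √(Nat.multinomial Finset.univ (α + Pi.single i 1)) =
      √(Nat.multinomial Finset.univ α) := by
  have h : (Nat.multinomial Finset.univ (α + Pi.single i 1) * (α i + 1) : ℝ) =
      Nat.multinomial Finset.univ α * ((∑ j, α j : ℕ) + 1) := by
    exact_mod_cast multinomial_add_single_mul α i
  rw [shiftWeight, ← Complex.ofReal_mul, ← Real.sqrt_mul (by positivity), div_mul_eq_mul_div,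
    mul_comm (_ + 1 : ℝ), h, mul_div_cancel_right₀ _ (by positivity)]

theorem coordPullback_monomialKernel (i : Fin d) (w : UnitBall d) :
    coordPullback i (monomialKernel w) = starRingEnd ℂ (w.1 i) • monomialKernel w := by
  ext α
  have hprod : ∏ j, w.1 j ^ (α + Pi.single i 1 : Fin d → ℕ) j = w.1 i * ∏ j, w.1 j ^ α j := by
    simp only [Pi.add_apply, pow_add, Finset.prod_mul_distrib]
    simp [Pi.single_apply, mul_comm]
  rw [coordPullback, weightedPullback_apply, monomialKernel_apply, hprod, ← mul_assoc,
    shiftWeight_mul_sqrt_multinomial, map_mul, mul_left_comm]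
  rfl

/-- The operator of multiplication by the `i`-th coordinate on the Drury–Arveson space. -/
def coordMul (i : Fin d) : DruryArveson d →L[ℂ] DruryArveson d :=
  (monomialEmbedding d).toContinuousLinearMap.adjoint ∘L (coordPullback i).adjoint ∘L
    (monomialEmbedding d).toContinuousLinearMap

theorem coordMul_apply (i : Fin d) (f : DruryArveson d) (w : UnitBall d) :
    coordMul i f w = w.1 i * f w := by
  rw [← inner_kerFun_one, coordMul, ContinuousLinearMap.comp_apply, ContinuousLinearMap.comp_apply,
    ContinuousLinearMap.adjoint_inner_right, ContinuousLinearMap.adjoint_inner_right]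
  simp only [LinearIsometry.coe_toContinuousLinearMap]
  rw [monomialEmbedding_kerFun_one, coordPullback_monomialKernel, inner_smul_left,
    Complex.conj_conj, inner_monomialKernel_monomialEmbedding]

theorem coordMul_mem_multiplierAlgebra (i : Fin d) :
    coordMul i ∈ multiplierAlgebra (DruryArveson d) :=
  ⟨fun w => w.1 i, fun f => ⟨coordMul i f, coordMul_apply i f⟩, coordMul_apply i⟩

theorem hasSum_norm_sq_monomialEmbedding (f : DruryArveson d) :
    HasSum (fun α => ‖monomialEmbedding d f α‖ ^ 2) (‖f‖ ^ 2) := by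
  simpa using hasSum_norm_sq_lp (monomialEmbedding d f)

theorem hasSum_norm_sq_adjoint_coordPullback (i : Fin d) (g : MonomialSpace d) :
    HasSum (fun α => ((α i + 1) / ((∑ j, α j : ℕ) + 1) : ℝ) * ‖g α‖ ^ 2)
      (‖(coordPullback i).adjoint g‖ ^ 2) := by
  simp only [← norm_sq_shiftWeight]
  exact hasSum_norm_sq_adjoint_weightedPullback _ _ g

theorem norm_coordMul_le_norm_adjoint_coordPullback (i : Fin d) (f : DruryArveson d) :
    ‖coordMul i f‖ ≤ ‖(coordPullback i).adjoint (monomialEmbedding d f)‖ :=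
  norm_adjoint_toContinuousLinearMap_le (monomialEmbedding d) _

theorem norm_coordMul_le (i : Fin d) (f : DruryArveson d) : ‖coordMul i f‖ ≤ ‖f‖ := by
  refine (norm_coordMul_le_norm_adjoint_coordPullback i f).trans
    (le_of_sq_le_sq ?_ (norm_nonneg _))
  refine hasSum_le (fun α => ?_) (hasSum_norm_sq_adjoint_coordPullback i (monomialEmbedding d f))
    (hasSum_norm_sq_monomialEmbedding f)
  rw [← norm_sq_shiftWeight]
  exact mul_le_of_le_one_left (by positivity) (pow_le_one₀ (norm_nonneg _)
    (norm_shiftWeight_le_one i α))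

end CoordMul

section DruryArvesonOne

variable {d : ℕ}

/-- The constant function `1` in the Drury–Arveson space: it is the reproducing kernel at `0`. -/
def druryArvesonOne (d : ℕ) : DruryArveson d :=
  RKHS.kerFun (DruryArveson d) ⟨0, Metric.mem_ball_self one_pos⟩ 1

theorem druryArvesonOne_apply (w : UnitBall d) : druryArvesonOne d w = 1 := by
  rw [druryArvesonOne, RKHS.kerFun_apply, kernel_druryArveson]
  simp [druryArvesonKernel]

theorem norm_druryArvesonOne (d : ℕ) : ‖druryArvesonOne d‖ = 1 := by
  rw [@norm_eq_sqrt_re_inner ℂ, druryArvesonOne, inner_kerFun_druryArveson]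
  simp

theorem monomialEmbedding_apply_zero (f : DruryArveson d) :
    monomialEmbedding d f 0 = inner ℂ (druryArvesonOne d) f := by
  have h : monomialEmbedding d (druryArvesonOne d) = lp.single 2 0 1 := by
    rw [druryArvesonOne, monomialEmbedding_kerFun_one]
    ext α
    rw [monomialKernel_apply]
    obtain rfl | hα := eq_or_ne α 0
    · simp [Nat.multinomial]
    · obtain ⟨i, hi⟩ := Function.ne_iff.1 hα
      rw [Finset.prod_eq_zero (Finset.mem_univ i) (zero_pow hi), lp.single_apply_ne _ _ _ hα]
      simp
  rw [← LinearIsometry.inner_map_map (monomialEmbedding d), h, lp.inner_single_left]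
  simp

theorem sum_add_one_div_le {ι : Type*} [Fintype ι] [Nonempty ι] {p : ι → Fin d}
    (hp : Function.Injective p) {α : Fin d → ℕ} (hα : α ≠ 0) :
    ∑ t, ((α (p t) + 1) / ((∑ j, α j : ℕ) + 1) : ℝ) ≤ (Fintype.card ι + 1) / 2 := by
  have hle : ∑ t, α (p t) ≤ ∑ j, α j := by
    refine (Finset.sum_map Finset.univ ⟨p, hp⟩ α).symm.trans_le ?_
    exact Finset.sum_le_sum_of_subset (Finset.subset_univ _)
  have hone : 1 ≤ ∑ j, α j := by
    obtain ⟨i, hi⟩ := Function.ne_iff.1 hα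
    exact (Nat.one_le_iff_ne_zero.2 hi).trans
      (Finset.single_le_sum (fun j _ => Nat.zero_le _) (Finset.mem_univ i))
  have hcard : 1 ≤ Fintype.card ι := Fintype.card_pos
  rw [← Finset.sum_div, Finset.sum_add_distrib, div_le_div_iff₀ (by positivity) two_pos]
  simp only [Finset.sum_const, Finset.card_univ, nsmul_eq_mul, mul_one]
  have hle' : (∑ t, α (p t) : ℝ) ≤ (∑ j, α j : ℕ) := by exact_mod_cast hle
  have hone' : (1 : ℝ) ≤ (∑ j, α j : ℕ) := by exact_mod_cast hone
  have hcard' : (1 : ℝ) ≤ Fintype.card ι := by exact_mod_cast hcard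
  nlinarith [mul_nonneg (sub_nonneg.2 hone') (sub_nonneg.2 hcard')]

theorem sum_norm_sq_coordMul_le {ι : Type*} [Fintype ι] [Nonempty ι] {p : ι → Fin d}
    (hp : Function.Injective p) {f : DruryArveson d} (hf : inner ℂ (druryArvesonOne d) f = 0) :
    ∑ t, ‖coordMul (p t) f‖ ^ 2 ≤ (Fintype.card ι + 1) / 2 * ‖f‖ ^ 2 := by
  have hshift := hasSum_sum fun t (_ : t ∈ Finset.univ) =>
    hasSum_norm_sq_adjoint_coordPullback (p t) (monomialEmbedding d f)
  refine (Finset.sum_le_sum fun t _ => pow_le_pow_left₀ (norm_nonneg _)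
    (norm_coordMul_le_norm_adjoint_coordPullback (p t) f) 2).trans (hasSum_le (fun α => ?_) hshift
      ((hasSum_norm_sq_monomialEmbedding f).mul_left _))
  obtain rfl | hα := eq_or_ne α 0
  · simp [monomialEmbedding_apply_zero, hf]
  · rw [← Finset.sum_mul]
    exact mul_le_mul_of_nonneg_right (sum_add_one_div_le hp hα) (by positivity)

theorem norm_sq_kerFun_sub_druryArvesonOne (w : UnitBall d) :
    ‖RKHS.kerFun (DruryArveson d) w 1 - druryArvesonOne d‖ ^ 2 = ‖w.1‖ ^ 2 / (1 - ‖w.1‖ ^ 2) := by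
  have hw : ‖w.1‖ ^ 2 < 1 :=
    pow_lt_one₀ (norm_nonneg _) (mem_ball_zero_iff.1 w.2) two_ne_zero
  have hker : ‖RKHS.kerFun (DruryArveson d) w 1‖ ^ 2 = (1 - ‖w.1‖ ^ 2)⁻¹ := by
    have h := inner_kerFun_druryArveson w w
    rw [inner_self_eq_norm_sq_to_K, inner_self_eq_norm_sq_to_K] at h
    refine RCLike.ofReal_injective (K := ℂ) ?_
    push_cast
    exact h
  rw [@norm_sub_sq ℂ, hker, norm_druryArvesonOne, inner_kerFun_one, druryArvesonOne_apply]
  have : 1 - ‖w.1‖ ^ 2 ≠ 0 := by linarith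
  rw [RCLike.one_re]
  field_simp
  ring

theorem norm_sq_apply_sub_apply_zero_le (f : DruryArveson d) (w : UnitBall d) :
    ‖f w - f ⟨0, Metric.mem_ball_self one_pos⟩‖ ^ 2 ≤
      ‖w.1‖ ^ 2 / (1 - ‖w.1‖ ^ 2) * ‖f‖ ^ 2 := by
  rw [← inner_kerFun_one, ← inner_kerFun_one, ← inner_sub_left,
    ← norm_sq_kerFun_sub_druryArvesonOne, ← mul_pow]
  exact pow_le_pow_left₀ (norm_nonneg _) (norm_inner_le_norm _ _) 2

theorem norm_coordMul_druryArvesonOne (i : Fin d) : ‖coordMul i (druryArvesonOne d)‖ = 1 := by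
  refine le_antisymm ((norm_coordMul_le i _).trans (norm_druryArvesonOne d).le) ?_
  have hbound : ∀ r ∈ Set.Ioo (0 : ℝ) 1, 1 - r ^ 2 ≤ ‖coordMul i (druryArvesonOne d)‖ ^ 2 := by
    rintro r ⟨hr₀, hr₁⟩
    have hnorm : ‖EuclideanSpace.single i (r : ℂ)‖ = r := by simp [abs_of_pos hr₀]
    have h := norm_sq_apply_sub_apply_zero_le (coordMul i (druryArvesonOne d))
      ⟨EuclideanSpace.single i (r : ℂ), mem_ball_zero_iff.2 (hnorm.trans_lt hr₁)⟩
    simp only [coordMul_apply, druryArvesonOne_apply, hnorm, PiLp.single_apply, if_true,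
      PiLp.zero_apply, mul_one, sub_zero, Complex.norm_real, Real.norm_of_nonneg hr₀.le] at h
    rw [div_mul_eq_mul_div, le_div_iff₀ (by nlinarith)] at h
    exact le_of_mul_le_mul_left h (by positivity)
  have hlim : Filter.Tendsto (fun r : ℝ => 1 - r ^ 2) (nhdsWithin 0 (Set.Ioi 0)) (nhds 1) := by
    have : Continuous fun r : ℝ => 1 - r ^ 2 := by fun_prop
    simpa using (this.tendsto 0).mono_left nhdsWithin_le_nhds
  exact (one_le_sq_iff₀ (norm_nonneg _)).1 <| le_of_tendsto hlim <|
    Filter.eventually_of_mem (Ioo_mem_nhdsGT one_pos) hbound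

end DruryArvesonOne

section NormalizedCoordMul

variable {d : ℕ} {ι : Type*} [Fintype ι]

/-- The coordinate multiplications `z_{p t}`, scaled so that the column they form is contractive,
with norm attained at the constant function `1`. -/
def normalizedCoordMul (p : ι → Fin d) (t : ι) : DruryArveson d →L[ℂ] DruryArveson d :=
  ((√(Fintype.card ι))⁻¹ : ℂ) • coordMul (p t)

theorem norm_sq_column_normalizedCoordMul (p : ι → Fin d) (f : DruryArveson d) :
    ‖column (normalizedCoordMul p) f‖ ^ 2 = (∑ t, ‖coordMul (p t) f‖ ^ 2) / Fintype.card ι := by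
  rw [norm_sq_column_apply, Finset.sum_div]
  simp [normalizedCoordMul, norm_smul, mul_pow, div_eq_inv_mul]

variable [Nonempty ι]

theorem norm_column_normalizedCoordMul_le (p : ι → Fin d) (f : DruryArveson d) :
    ‖column (normalizedCoordMul p) f‖ ≤ ‖f‖ := by
  refine le_of_sq_le_sq ?_ (norm_nonneg f)
  rw [norm_sq_column_normalizedCoordMul, div_le_iff₀' (by positivity), ← nsmul_eq_mul]
  exact Finset.sum_le_card_nsmul _ _ _ fun t _ =>
    pow_le_pow_left₀ (norm_nonneg _) (norm_coordMul_le (p t) f) 2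

theorem norm_column_normalizedCoordMul_druryArvesonOne (p : ι → Fin d) :
    ‖column (normalizedCoordMul p) (druryArvesonOne d)‖ = 1 := by
  rw [← sq_eq_sq₀ (norm_nonneg _) zero_le_one, norm_sq_column_normalizedCoordMul]
  simp [norm_coordMul_druryArvesonOne]

theorem norm_column_normalizedCoordMul_le_of_inner_eq_zero {p : ι → Fin d}
    (hp : Function.Injective p) {f : DruryArveson d} (hf : inner ℂ (druryArvesonOne d) f = 0) :
    ‖column (normalizedCoordMul p) f‖ ≤
      √((Fintype.card ι + 1) / (2 * Fintype.card ι)) * ‖f‖ := by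
  refine le_of_sq_le_sq ?_ (by positivity)
  rw [norm_sq_column_normalizedCoordMul, mul_pow, Real.sq_sqrt (by positivity), ← div_div,
    div_mul_eq_mul_div]
  exact div_le_div_of_nonneg_right (sum_norm_sq_coordMul_le hp hf) (by positivity)

end NormalizedCoordMul

theorem mainTheorem5_general {d k : ℕ} (hd : 2 ≤ d) (hk : 4 ≤ k) :
    ¬ HasA11 (matrixAlgebra k (multiplierAlgebra (DruryArveson d))) := by
  have hp : Function.Injective (Fin.castLE hd) := Fin.castLE_injective hd
  refine not_hasA11_matrixAlgebra (by simpa using hk)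
    (fun t => Subalgebra.smul_mem _ (coordMul_mem_multiplierAlgebra _) _)
    (norm_druryArvesonOne d) (norm_column_normalizedCoordMul_druryArvesonOne (Fin.castLE hd))
    (norm_column_normalizedCoordMul_le _) (Real.sqrt_nonneg _) ?_
    fun f hf => norm_column_normalizedCoordMul_le_of_inner_eq_zero hp hf
  rw [Real.sqrt_lt' one_pos, Fintype.card_fin]
  norm_num

theorem mainTheorem5 (d : ℕ) (hd : 2 ≤ d) :
    ¬ HasA11 (matrixAlgebra 6 (multiplierAlgebra (DruryArveson d))) :=
  mainTheorem5_general hd (by norm_num)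

end
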